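/- Let $\lambda$ be an infinite cardinal number and let the scalar field $\mathbb{K}$ be $\mathbb{R}$ or $\mathbb{C}$. Let $\ell_\infty(\lambda)$ be the Banach space of bounded functions $\lambda\to\mathbb{K}$ with the supremum norm, and let $\ell_\infty^c(\lambda)$ be its closed subspace $\{z\in\ell_\infty(\lambda)\colon z(\alpha)\neq 0 \text{ for at most countably many } \alpha<\lambda\}$. Let $X$ be either $\ell_\infty(\lambda)$ or $\ell_\infty^c(\lambda)$, and let $\mathscr{B}(X)$ be the Banach algebra of bounded linear operators on $X$. An operator $T\in\mathscr{B}(X)$ is *bounded below on a copy of $X$* if there are a subspace $E_0$ of $X$ that is isomorphic to $X$ (linearly homeomorphic) and a constant $c>0$ with $\|Tx\|\geqslant c\|x\|$ for all $x\in E_0$. Put $$\mathscr{S}_X(X)=\{T\in\mathscr{B}(X)\colon T\text{ is not bounded below on any copy of }X\}.$$ Then $$\mathscr{S}_X(X)=\{T\in\mathscr{B}(X)\colon I_X\neq ATB\text{ for all }A,B\in\mathscr{B}(X)\},$$ and this set is the unique maximal two-sided ideal of $\mathscr{B}(X)$. -/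

import Mathlib

namespace OperatorIdeals

/-- `T` is bounded below on a copy of `E`: there is a subspace `E₀` of the domain of `T`, isomorphic
to `E` as a Banach space (linearly homeomorphic), such that `‖T x‖ ≥ c ‖x‖` on `E₀` for some
constant `c > 0`. -/
def BoundedBelowOnCopy {𝕜 X Y : Type*} [RCLike 𝕜]
    [NormedAddCommGroup X] [NormedSpace 𝕜 X] [NormedAddCommGroup Y] [NormedSpace 𝕜 Y]
    (E : Type*) [NormedAddCommGroup E] [NormedSpace 𝕜 E] (T : X →L[𝕜] Y) : Prop :=
  ∃ E₀ : Submodule 𝕜 X, Nonempty (E₀ ≃L[𝕜] E) ∧ ∃ c : ℝ, 0 < c ∧ ∀ x ∈ E₀, c * ‖x‖ ≤ ‖T x‖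

/-- The set `𝒮_E(X, Y)` of `E`-singular operators from `X` to `Y`. -/
def singularOperators (𝕜 E X Y : Type*) [RCLike 𝕜] [NormedAddCommGroup E] [NormedSpace 𝕜 E]
    [NormedAddCommGroup X] [NormedSpace 𝕜 X] [NormedAddCommGroup Y] [NormedSpace 𝕜 Y] :
    Set (X →L[𝕜] Y) :=
  {T | ¬ BoundedBelowOnCopy E T}

/-- The subset `S` is the unique maximal (two-sided) ideal of the unital ring `A`: it is an ideal,
it is maximal among the proper ideals, and every maximal ideal equals it. -/
def IsUniqueMaximalIdeal {A : Type*} [Ring A] (S : Set A) : Prop :=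
  ∃ M : TwoSidedIdeal A, (M : Set A) = S ∧ IsCoatom M ∧ ∀ N : TwoSidedIdeal A, IsCoatom N → N = M

/-- `ℓ_∞(ι)`, the Banach space of bounded scalar functions on `ι` with the supremum norm. -/
abbrev LInfty (𝕜 ι : Type*) [RCLike 𝕜] : Type _ := lp (fun _ : ι => 𝕜) (⊤ : ENNReal)

/-- `ℓ_∞^c(ι)`, the subspace of `ℓ_∞(ι)` of the functions with countable support. -/
def LInftyCountable (𝕜 ι : Type*) [RCLike 𝕜] : Submodule 𝕜 (LInfty 𝕜 ι) where
  carrier := {z | {i : ι | z i ≠ 0}.Countable}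
  zero_mem' := by simp
  add_mem' := by
    intro a b ha hb
    refine (Set.Countable.union ha hb).mono ?_
    intro i hi
    by_contra h
    simp only [Set.mem_union, Set.mem_ofPred_eq, not_or, not_not] at h
    exact hi (by simp [h.1, h.2])
  smul_mem' := by
    intro c a ha
    refine Set.Countable.mono ?_ ha
    intro i hi h
    exact hi (by simp [h])

end OperatorIdeals

/-!
The identity factors through every operator that has a uniformly large "generalised diagonal", and
everything follows from that.

Both spaces consist of bounded functions on `ι` with the supremum norm and are closed under moving
and shrinking supports; `SymmetricSupSpace` records exactly what is used. Suppose that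
`|(T e_{g i})(f i)| ≥ δ > 0` for all `i`, with `f, g : ι → ι` injective. Rosenthal's lemma on
superadditive set functions (`exists_injective_le_of_superadditive`), applied to the norms of
`x ↦ (T x)(f i)` on functions supported in a set, gives a set of indices of full cardinality on
which `T`, compressed and divided by its diagonal, is within `1/2` of the identity. The Neumann
series inverts it, so `1 = A T B` (`exists_mul_mul_eq_one_of_le_norm`).

* If `T` is bounded below on a copy of the space, let `U` be `T` composed with an isomorphism onto
  that copy. Each `U e_i` has a coordinate `f i` of modulus at least `δ`. A bounded functional is
  large at only finitely many `e_i`, so `f` is finite-to-one and hence injective on a set of full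
  cardinality; the criterion applies to `U`. No injectivity of the space, and no complementation of
  the copy, is needed.
* If `1 = P + Q`, then at each `i` one of `(P e_i)(i)`, `(Q e_i)(i)` has modulus at least `1/2`, and
  one of the two operators wins on a set of full cardinality. Hence the operators through which the
  identity does not factor are closed under addition, and in any ring this makes them the unique
  maximal ideal (`isUniqueMaximalIdeal_of_add_mem`).
-/

open Function Set

namespace OperatorIdeals

/-! ### The elements through which the identity does not factor -/

/-- In any ring, the set of elements through which `1` does not factor is closed under
multiplication and contains every proper ideal; only closure under addition is in question. -/
theorem isUniqueMaximalIdeal_of_add_mem {A : Type*} [Ring A] [Nontrivial A]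
    (hadd : ∀ p q : A, p + q = 1 → (∃ a b, a * p * b = 1) ∨ ∃ a b, a * q * b = 1) :
    IsUniqueMaximalIdeal {t : A | ∀ a b : A, a * t * b ≠ 1} := by
  let M : TwoSidedIdeal A := TwoSidedIdeal.mk' {t : A | ∀ a b : A, a * t * b ≠ 1}
    (fun a b h ↦ by simp at h)
    (by
      intro x y hx hy a b h
      rcases hadd (a * x * b) (a * y * b) (by rw [← h]; noncomm_ring) with
        ⟨c, d, hcd⟩ | ⟨c, d, hcd⟩
      · exact hx (c * a) (b * d) (by simpa only [mul_assoc] using hcd)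
      · exact hy (c * a) (b * d) (by simpa only [mul_assoc] using hcd))
    (by
      intro x hx a b h
      exact hx (-a) b (by simpa using h))
    (by
      intro x y hy a b h
      exact hy (a * x) b (by simpa only [mul_assoc] using h))
    (by
      intro x y hx a b h
      exact hx a (y * b) (by simpa only [mul_assoc] using h))
  have hM : (M : Set A) = {t : A | ∀ a b : A, a * t * b ≠ 1} := TwoSidedIdeal.coe_mk' ..
  have htop (N : TwoSidedIdeal A) (hN : ¬ N ≤ M) : N = ⊤ := by
    rw [TwoSidedIdeal.le_iff, hM, Set.not_subset] at hN
    obtain ⟨t, htN, ht⟩ := hN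
    simp only [Set.mem_ofPred_eq, not_forall, not_not] at ht
    obtain ⟨a, b, hab⟩ := ht
    rw [← TwoSidedIdeal.one_mem_iff, ← hab]
    exact N.mul_mem_right _ _ (N.mul_mem_left _ _ htN)
  have hM1 : M ≠ ⊤ := by
    rw [Ne, ← TwoSidedIdeal.one_mem_iff]
    intro h
    have h' : (1 : A) ∈ (M : Set A) := h
    rw [hM] at h'
    exact h' 1 1 (by simp)
  refine ⟨M, hM, ⟨hM1, fun N hN ↦ htop N hN.not_ge⟩, fun N hN ↦ ?_⟩
  have hNM : N ≤ M := by
    by_contra h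
    exact hN.1 (htop N h)
  by_contra hne
  exact hM1 (hN.2 M (lt_of_le_of_ne hNM hne))

/-! ### Combinatorics of infinite index sets -/

/-- Rosenthal's lemma. If `v i` are uniformly bounded, monotone and superadditive set functions,
then, on a set of indices of full cardinality (the range of `k`), each `v i` is at most `ε` off the
index `i` itself. Superadditivity is only needed for disjoint sets. -/
theorem exists_injective_le_of_superadditive {ι : Type*} [Infinite ι] (v : ι → Set ι → ℝ)
    (hmono : ∀ i s t, s ⊆ t → v i s ≤ v i t)
    (hadd : ∀ i s t, Disjoint s t → v i s + v i t ≤ v i (s ∪ t))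
    {C : ℝ} (hC : ∀ i s, v i s ≤ C) {ε : ℝ} (hε : 0 < ε) :
    ∃ k : ι → ι, Injective k ∧ ∀ i, v (k i) (range k \ {k i}) ≤ ε := by
  obtain ⟨e⟩ : Nonempty (ι × ι ≃ ι) := by
    rw [← Cardinal.eq, Cardinal.mk_prod, Cardinal.lift_id]
    exact Cardinal.mul_eq_self (Cardinal.aleph0_le_mk ι)
  have key (n : ℕ) : ∀ h : ι → ι, Injective h → (∀ i, v (h i) (range h) ≤ n * ε) →
      ∃ k : ι → ι, Injective k ∧ ∀ i, v (k i) (range k \ {k i}) ≤ ε := by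
    induction n with
    | zero =>
      intro h hh hv
      exact ⟨h, hh, fun i ↦ (hmono _ _ _ sdiff_subset).trans
        ((hv i).trans (by simpa using hε.le))⟩
    | succ n ih =>
      intro h hh hv
      by_cases hj : ∃ j, ∀ i, v (h (e (j, i))) (range (fun i ↦ h (e (j, i))) \ {h (e (j, i))}) ≤ ε
      · obtain ⟨j, hj⟩ := hj
        refine ⟨fun i ↦ h (e (j, i)), fun a b hab ↦ ?_, hj⟩
        simpa using e.injective (hh hab)
      -- Every block contains a bad index `m j`. Off `m j`, the block is disjoint from the set of
      -- bad indices, so passing to the bad indices costs each of their set functions at least `ε`.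
      · push Not at hj
        choose m hm using hj
        refine ih (fun j ↦ h (e (j, m j))) (fun a b hab ↦ ?_) fun j ↦ ?_
        · exact (Prod.ext_iff.1 (e.injective (hh hab))).1
        · have hdisj : Disjoint (range fun j ↦ h (e (j, m j)))
              (range (fun i ↦ h (e (j, i))) \ {h (e (j, m j))}) := by
            rw [Set.disjoint_left]
            rintro _ ⟨j', rfl⟩ ⟨⟨i, hi⟩, hne⟩
            have h1 := Prod.ext_iff.1 (e.injective (hh hi))
            have h2 : j = j' := h1.1
            subst h2
            exact hne rfl
          have hsub : (range fun j ↦ h (e (j, m j))) ∪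
              (range (fun i ↦ h (e (j, i))) \ {h (e (j, m j))}) ⊆ range h := by
            rintro _ (⟨j', rfl⟩ | ⟨⟨i, rfl⟩, -⟩) <;> exact mem_range_self _
          have h1 := hadd (h (e (j, m j))) _ _ hdisj
          have h2 := hmono (h (e (j, m j))) _ _ hsub
          have h3 := hv (e (j, m j))
          have h4 := hm j
          push_cast at h3
          linarith
  -- The descent starts at any `n` with `C ≤ n * ε` and has nothing left to lose at `n = 0`.
  obtain ⟨n, hn⟩ := exists_nat_ge (C / ε)
  exact key n id injective_id fun i ↦ (hC _ _).trans ((div_le_iff₀ hε).1 hn)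

/-- A finite-to-one self-map of an infinite type is injective on a set of full cardinality. -/
theorem exists_injective_comp_of_finite_fibers {ι : Type*} [Infinite ι] (f : ι → ι)
    (hf : ∀ j, (f ⁻¹' {j}).Finite) : ∃ g : ι → ι, Injective g ∧ Injective (f ∘ g) := by
  obtain ⟨e⟩ : Nonempty (ι ≃ range f) := by
    rw [← Cardinal.eq]
    refine le_antisymm (not_lt.1 fun hlt ↦ ?_) (Cardinal.mk_set_le _)
    obtain ⟨a, ha⟩ := Cardinal.exists_infinite_fiber (rangeFactorization f) hlt
    have hfin : (rangeFactorization f ⁻¹' {a}).Finite :=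
      (hf a).subset fun i hi ↦ congrArg Subtype.val hi
    exact (Set.infinite_coe_iff.1 ha) hfin
  have hs (i : ι) : ∃ j, f j = e i := (e i).2
  choose g hg using hs
  have hinj : Injective (f ∘ g) := fun a b hab ↦ by
    simp only [comp_apply, hg] at hab
    exact e.injective (Subtype.ext hab)
  exact ⟨g, hinj.of_comp, hinj⟩

theorem exists_injective_forall_or_forall {ι : Type*} [Infinite ι] {p q : ι → Prop}
    (h : ∀ i, p i ∨ q i) :
    (∃ g : ι → ι, Injective g ∧ ∀ i, p (g i)) ∨ ∃ g : ι → ι, Injective g ∧ ∀ i, q (g i) := by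
  have aux (s : Set ι) (hs : Cardinal.mk ι ≤ Cardinal.mk s) :
      ∃ g : ι → ι, Injective g ∧ ∀ i, g i ∈ s := by
    obtain ⟨e⟩ := hs
    exact ⟨fun i ↦ e i, Subtype.val_injective.comp e.injective, fun i ↦ (e i).2⟩
  by_contra hcon
  rw [not_or] at hcon
  have h1 : Cardinal.mk {i | p i} < Cardinal.mk ι := not_le.1 fun hle ↦ hcon.1 (aux _ hle)
  have h2 : Cardinal.mk ({i | p i}ᶜ : Set ι) < Cardinal.mk ι := not_le.1 fun hle ↦ by
    obtain ⟨g, hg, hgp⟩ := aux _ hle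
    exact hcon.2 ⟨g, hg, fun i ↦ (h (g i)).resolve_left (hgp i)⟩
  have h3 := Cardinal.add_lt_of_lt (Cardinal.aleph0_le_mk ι) h1 h2
  rw [Cardinal.mk_sum_compl] at h3
  exact h3.false

/-! ### Spaces of bounded functions with the supremum norm -/

open Classical in
/-- A realisation of the normed space `X` as a space of scalar functions on `ι` with the supremum
norm, which contains the unit vectors and is closed under moving and shrinking supports: a bounded
function belongs to it as soon as its support is covered by the image, under some map `σ` of the
index set, of the support of a function in the space. -/
structure SymmetricSupSpace (𝕜 ι X : Type*) [RCLike 𝕜] [NormedAddCommGroup X]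
    [NormedSpace 𝕜 X] where
  /-- The function represented by a vector. -/
  toFun : X →ₗ[𝕜] (ι → 𝕜)
  norm_toFun_le : ∀ x i, ‖toFun x i‖ ≤ ‖x‖
  norm_le : ∀ x C, 0 ≤ C → (∀ i, ‖toFun x i‖ ≤ C) → ‖x‖ ≤ C
  exists_single : ∀ i, ∃ x, toFun x = Pi.single i 1
  exists_of_support_subset : ∀ (x : X) (u : ι → 𝕜) (C : ℝ) (σ : ι → ι), (∀ i, ‖u i‖ ≤ C) →
    support u ⊆ σ '' support (toFun x) → ∃ y, toFun y = u

namespace SymmetricSupSpace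

variable {𝕜 ι X : Type*} [RCLike 𝕜] [NormedAddCommGroup X] [NormedSpace 𝕜 X]
  (V : SymmetricSupSpace 𝕜 ι X)

theorem toFun_injective : Injective V.toFun := by
  rw [injective_iff_map_eq_zero]
  intro x hx
  exact norm_le_zero_iff.1 (V.norm_le x 0 le_rfl fun i ↦ by simp [hx])

/-- The coordinate functional at `i`. -/
noncomputable def coord (i : ι) : X →L[𝕜] 𝕜 :=
  LinearMap.mkContinuous ((LinearMap.proj i).comp V.toFun) 1 fun x ↦ by
    simpa using V.norm_toFun_le x i

@[simp]
theorem coord_apply (i : ι) (x : X) : V.coord i x = V.toFun x i := rfl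

/-- The unit vector at `i`. -/
noncomputable def single (i : ι) : X := (V.exists_single i).choose

open Classical in
@[simp]
theorem toFun_single (i : ι) : V.toFun (V.single i) = Pi.single i 1 :=
  (V.exists_single i).choose_spec

theorem norm_single (i : ι) : ‖V.single i‖ = 1 := by
  classical
  refine le_antisymm (V.norm_le _ 1 zero_le_one fun j ↦ ?_) ?_
  · by_cases h : j = i
    · subst h; simp
    · simp [h]
  · simpa using V.norm_toFun_le (V.single i) i

/-- A weighted composition operator `x ↦ w · (x ∘ τ)` acts on the space if `τ` has a left inverse
`σ` on the support of the bounded weight `w`. Coordinate projections, relabellings of the index set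
and bounded diagonal operators are all of this form. -/
theorem exists_weightedComp (w : ι → 𝕜) (τ σ : ι → ι) {C : ℝ} (hC : 0 ≤ C)
    (hw : ∀ i, ‖w i‖ ≤ C) (hσ : ∀ i, w i ≠ 0 → σ (τ i) = i) :
    ∃ A : X →L[𝕜] X, ∀ x i, V.toFun (A x) i = w i * V.toFun x (τ i) := by
  have hb (x : X) (i : ι) : ‖w i * V.toFun x (τ i)‖ ≤ C * ‖x‖ := by
    rw [norm_mul]
    exact mul_le_mul (hw i) (V.norm_toFun_le x _) (norm_nonneg _) hC
  have hex (x : X) : ∃ y, V.toFun y = fun i ↦ w i * V.toFun x (τ i) := by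
    refine V.exists_of_support_subset x _ _ σ (hb x) fun i hi ↦ ?_
    exact ⟨τ i, right_ne_zero_of_mul hi, hσ i (left_ne_zero_of_mul hi)⟩
  choose a ha using hex
  let L : X →ₗ[𝕜] X :=
    { toFun := a
      map_add' := fun x y ↦ V.toFun_injective <| by
        ext i; simp [ha, mul_add]
      map_smul' := fun c x ↦ V.toFun_injective <| by
        ext i; simp [ha, mul_left_comm] }
  refine ⟨L.mkContinuous C fun x ↦ V.norm_le _ _ (by positivity) fun i ↦ ?_, fun x i ↦ ?_⟩
  · change ‖V.toFun (a x) i‖ ≤ _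
    rw [ha]
    exact hb x i
  · exact congrFun (ha x) i

open Classical in
theorem exists_restrict (s : Set ι) : ∃ A : X →L[𝕜] X,
    ∀ x i, V.toFun (A x) i = (if i ∈ s then 1 else 0) * V.toFun x i :=
  V.exists_weightedComp (fun i ↦ if i ∈ s then 1 else 0) id id zero_le_one
    (fun i ↦ by split_ifs <;> simp) fun _ _ ↦ rfl

/-- The projection onto the functions supported in `s`. -/
noncomputable def restrict (s : Set ι) : X →L[𝕜] X := (V.exists_restrict s).choose

theorem toFun_restrict_of_mem {s : Set ι} {i : ι} (hi : i ∈ s) (x : X) :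
    V.toFun (V.restrict s x) i = V.toFun x i := by
  refine ((V.exists_restrict s).choose_spec x i).trans ?_
  simp [hi]

theorem toFun_restrict_of_notMem {s : Set ι} {i : ι} (hi : i ∉ s) (x : X) :
    V.toFun (V.restrict s x) i = 0 := by
  refine ((V.exists_restrict s).choose_spec x i).trans ?_
  simp [hi]

theorem norm_restrict_apply_le (s : Set ι) (x : X) : ‖V.restrict s x‖ ≤ ‖x‖ := by
  refine V.norm_le _ _ (norm_nonneg x) fun i ↦ ?_
  by_cases hi : i ∈ s
  · simpa [V.toFun_restrict_of_mem hi] using V.norm_toFun_le x i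
  · simp [V.toFun_restrict_of_notMem hi]

theorem restrict_restrict_of_subset {s t : Set ι} (h : s ⊆ t) (x : X) :
    V.restrict t (V.restrict s x) = V.restrict s x := by
  refine V.toFun_injective (funext fun i ↦ ?_)
  by_cases hi : i ∈ t
  · rw [V.toFun_restrict_of_mem hi]
  · rw [V.toFun_restrict_of_notMem hi, V.toFun_restrict_of_notMem fun h' ↦ hi (h h')]

/-! ### The norm of a functional on the functions supported in a set -/

theorem norm_comp_restrict_le (φ : X →L[𝕜] 𝕜) (s : Set ι) : ‖φ.comp (V.restrict s)‖ ≤ ‖φ‖ :=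
  ContinuousLinearMap.opNorm_le_bound _ (norm_nonneg _) fun x ↦
    (φ.le_opNorm _).trans (by gcongr; exact V.norm_restrict_apply_le s x)

theorem norm_comp_restrict_mono (φ : X →L[𝕜] 𝕜) {s t : Set ι} (h : s ⊆ t) :
    ‖φ.comp (V.restrict s)‖ ≤ ‖φ.comp (V.restrict t)‖ :=
  ContinuousLinearMap.opNorm_le_bound _ (norm_nonneg _) fun x ↦ by
    have h1 := (φ.comp (V.restrict t)).le_opNorm (V.restrict s x)
    rw [ContinuousLinearMap.comp_apply, V.restrict_restrict_of_subset h] at h1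
    exact h1.trans (by gcongr; exact V.norm_restrict_apply_le s x)

/-- The norm on functions supported in `s` is superadditive in `s`: two disjointly supported vectors
of norm at most `1` may be rotated, so that `φ` is nonnegative at both, and then added without
leaving the unit ball. -/
theorem norm_comp_restrict_add_le (φ : X →L[𝕜] 𝕜) {s t : Set ι} (h : Disjoint s t) :
    ‖φ.comp (V.restrict s)‖ + ‖φ.comp (V.restrict t)‖ ≤ ‖φ.comp (V.restrict (s ∪ t))‖ := by
  have key (a b : ℝ) (ha : a < ‖φ.comp (V.restrict s)‖) (hb : b < ‖φ.comp (V.restrict t)‖) :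
      a + b ≤ ‖φ.comp (V.restrict (s ∪ t))‖ := by
    obtain ⟨x, hx1, hx⟩ := (φ.comp (V.restrict s)).exists_lt_apply_of_lt_opNorm ha
    obtain ⟨y, hy1, hy⟩ := (φ.comp (V.restrict t)).exists_lt_apply_of_lt_opNorm hb
    rw [ContinuousLinearMap.comp_apply] at hx hy
    obtain ⟨c, hc, hcx⟩ := RCLike.exists_norm_eq_mul_self (φ (V.restrict s x))
    obtain ⟨d, hd, hdy⟩ := RCLike.exists_norm_eq_mul_self (φ (V.restrict t y))
    set z : X := c • V.restrict s x + d • V.restrict t y with hz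
    have hz1 : ‖z‖ ≤ 1 := by
      refine V.norm_le _ _ zero_le_one fun i ↦ ?_
      have hxi := (V.norm_toFun_le x i).trans hx1.le
      have hyi := (V.norm_toFun_le y i).trans hy1.le
      by_cases his : i ∈ s
      · have hit : i ∉ t := Set.disjoint_left.1 h his
        simpa [hz, V.toFun_restrict_of_mem his, V.toFun_restrict_of_notMem hit, hc] using hxi
      · by_cases hit : i ∈ t
        · simpa [hz, V.toFun_restrict_of_notMem his, V.toFun_restrict_of_mem hit, hd] using hyi
        · simp [hz, V.toFun_restrict_of_notMem his, V.toFun_restrict_of_notMem hit]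
    have hφz : φ (V.restrict (s ∪ t) z) =
        ((‖φ (V.restrict s x)‖ + ‖φ (V.restrict t y)‖ : ℝ) : 𝕜) := by
      rw [hz, map_add, map_smul, map_smul, V.restrict_restrict_of_subset subset_union_left,
        V.restrict_restrict_of_subset subset_union_right, map_add, map_smul, map_smul,
        RCLike.ofReal_add, hcx, hdy, smul_eq_mul, smul_eq_mul]
    have h1 := (φ.comp (V.restrict (s ∪ t))).le_opNorm z
    rw [ContinuousLinearMap.comp_apply, hφz, RCLike.norm_ofReal, abs_of_nonneg (by positivity)]
      at h1
    have h2 := mul_le_mul_of_nonneg_left hz1 (norm_nonneg (φ.comp (V.restrict (s ∪ t))))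
    linarith
  refine le_of_forall_pos_lt_add fun ε hε ↦ ?_
  have := key (‖φ.comp (V.restrict s)‖ - ε / 3) (‖φ.comp (V.restrict t)‖ - ε / 3)
    (by linarith) (by linarith)
  linarith

theorem norm_apply_single_le (φ : X →L[𝕜] 𝕜) {s : Set ι} {i : ι} (hi : i ∈ s) :
    ‖φ (V.single i)‖ ≤ ‖φ.comp (V.restrict s)‖ := by
  classical
  have h1 : V.restrict s (V.single i) = V.single i := by
    refine V.toFun_injective (funext fun j ↦ ?_)
    by_cases hj : j ∈ s
    · rw [V.toFun_restrict_of_mem hj]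
    · rw [V.toFun_restrict_of_notMem hj, toFun_single, Pi.single_eq_of_ne]
      rintro rfl
      exact hj hi
  have h2 := (φ.comp (V.restrict s)).le_opNorm (V.single i)
  rwa [ContinuousLinearMap.comp_apply, h1, norm_single, mul_one] at h2

theorem sum_norm_apply_single_le (φ : X →L[𝕜] 𝕜) (F : Finset ι) :
    ∑ i ∈ F, ‖φ (V.single i)‖ ≤ ‖φ.comp (V.restrict (F : Set ι))‖ := by
  classical
  induction F using Finset.induction_on with
  | empty => simp
  | insert a F ha ih =>
    rw [Finset.sum_insert ha, Finset.coe_insert, Set.insert_eq]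
    refine le_trans (add_le_add (V.norm_apply_single_le φ (Set.mem_singleton a)) ih) ?_
    exact V.norm_comp_restrict_add_le φ (by simpa using ha)

theorem finite_setOf_le_norm_apply_single (φ : X →L[𝕜] 𝕜) {δ : ℝ} (hδ : 0 < δ) :
    {i | δ ≤ ‖φ (V.single i)‖}.Finite := by
  by_contra hinf
  obtain ⟨n, hn⟩ := exists_nat_gt (‖φ‖ / δ)
  obtain ⟨F, hF, hcard⟩ := Set.Infinite.exists_subset_card_eq hinf n
  have h1 := (V.sum_norm_apply_single_le φ F).trans (V.norm_comp_restrict_le φ _)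
  have h2 : F.card • δ ≤ ∑ i ∈ F, ‖φ (V.single i)‖ :=
    Finset.card_nsmul_le_sum _ _ _ fun i hi ↦ hF hi
  rw [hcard, nsmul_eq_mul] at h2
  rw [div_lt_iff₀ hδ] at hn
  linarith

/-! ### Factoring the identity through an operator -/

variable [Infinite ι]

/-- The operator sending `e_i` to `e_{g i}`, extended by zero off the range of `g`. -/
theorem exists_relabel (V : SymmetricSupSpace 𝕜 ι X) {g : ι → ι} (hg : Injective g) :
    ∃ J : X →L[𝕜] X, (∀ x i, V.toFun (J x) (g i) = V.toFun x i) ∧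
      ∀ x, ∀ j ∉ range g, V.toFun (J x) j = 0 := by
  classical
  obtain ⟨J, hJ⟩ := V.exists_weightedComp (fun j ↦ if j ∈ range g then 1 else 0) (invFun g) g
    zero_le_one (fun i ↦ by split_ifs <;> simp) fun i hi ↦ by
      have : i ∈ range g := by by_contra h; simp [h] at hi
      exact invFun_eq this
  refine ⟨J, fun x i ↦ ?_, fun x j hj ↦ ?_⟩
  · rw [hJ, if_pos (mem_range_self i), leftInverse_invFun hg, one_mul]
  · rw [hJ, if_neg hj, zero_mul]

theorem exists_compRight (V : SymmetricSupSpace 𝕜 ι X) {f : ι → ι} (hf : Injective f)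
    (w : ι → 𝕜) {C : ℝ} (hC : 0 ≤ C) (hw : ∀ i, ‖w i‖ ≤ C) :
    ∃ R : X →L[𝕜] X, ∀ x i, V.toFun (R x) i = w i * V.toFun x (f i) :=
  V.exists_weightedComp w f (invFun f) hC hw fun i _ ↦ leftInverse_invFun hf i

/-- The identity factors through an operator whose diagonal is bounded away from zero. -/
theorem exists_mul_mul_eq_one_of_le_norm_diag [CompleteSpace X] (T : X →L[𝕜] X) {δ : ℝ}
    (hδ : 0 < δ) (hT : ∀ i, δ ≤ ‖V.toFun (T (V.single i)) i‖) :
    ∃ A B : X →L[𝕜] X, A * T * B = 1 := by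
  classical
  obtain ⟨k, hk, hkT⟩ := exists_injective_le_of_superadditive
    (fun i s ↦ ‖((V.coord i).comp T).comp (V.restrict s)‖)
    (fun i s t h ↦ V.norm_comp_restrict_mono _ h)
    (fun i s t h ↦ V.norm_comp_restrict_add_le _ h) (C := ‖T‖)
    (fun i s ↦ (V.norm_comp_restrict_le _ s).trans <|
      ContinuousLinearMap.opNorm_le_bound _ (norm_nonneg _) fun x ↦
        (V.norm_toFun_le _ i).trans (T.le_opNorm x)) (half_pos hδ)
  let d (i : ι) : 𝕜 := V.toFun (T (V.single (k i))) (k i)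
  have hd (i : ι) : δ ≤ ‖d i‖ := hT (k i)
  have hd0 (i : ι) : d i ≠ 0 := norm_pos_iff.1 (hδ.trans_le (hd i))
  have hdinv (i : ι) : ‖(d i)⁻¹‖ ≤ δ⁻¹ := by
    rw [norm_inv]
    exact inv_anti₀ hδ (hd i)
  obtain ⟨J, hJ, hJ0⟩ := V.exists_relabel hk
  obtain ⟨R, hR⟩ := V.exists_compRight hk (fun i ↦ (d i)⁻¹) (inv_nonneg.2 hδ.le) hdinv
  have hJnorm (x : X) : ‖J x‖ ≤ ‖x‖ := by
    refine V.norm_le _ _ (norm_nonneg _) fun j ↦ ?_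
    by_cases hj : j ∈ range k
    · obtain ⟨i, rfl⟩ := hj
      rw [hJ]
      exact V.norm_toFun_le x i
    · simp [hJ0 x j hj]
  have hsplit (x : X) (i : ι) :
      J x = V.toFun x i • V.single (k i) + V.restrict (range k \ {k i}) (J x) := by
    refine V.toFun_injective (funext fun j ↦ ?_)
    by_cases hji : j = k i
    · subst hji
      simp [hJ, V.toFun_restrict_of_notMem (s := range k \ {k i}) (i := k i) (by simp)]
    · by_cases hj : j ∈ range k
      · simp [hji, V.toFun_restrict_of_mem (s := range k \ {k i}) ⟨hj, hji⟩]
      · simp [hji, hJ0 x j hj,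
          V.toFun_restrict_of_notMem (s := range k \ {k i}) fun h ↦ hj h.1]
  have hclose : ‖1 - R * T * J‖ ≤ 1 / 2 := by
    refine ContinuousLinearMap.opNorm_le_bound _ (by norm_num) fun x ↦
      V.norm_le _ _ (by positivity) fun i ↦ ?_
    have h1 : V.toFun (T (J x)) (k i) = V.toFun x i * d i +
        (((V.coord (k i)).comp T).comp (V.restrict (range k \ {k i}))) (J x) := by
      conv_lhs => rw [hsplit x i]
      simp [d]
    have h2 : V.toFun ((1 - R * T * J) x) i = -((d i)⁻¹ *
        (((V.coord (k i)).comp T).comp (V.restrict (range k \ {k i}))) (J x)) := by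
      change V.toFun (x - R (T (J x))) i = _
      rw [map_sub, Pi.sub_apply, hR, h1]
      have := hd0 i
      field_simp
      ring
    rw [h2, norm_neg, norm_mul]
    calc _ ≤ δ⁻¹ * (δ / 2 * ‖x‖) := by
          refine mul_le_mul (hdinv i) ?_ (norm_nonneg _) (inv_nonneg.2 hδ.le)
          refine (ContinuousLinearMap.le_opNorm _ _).trans ?_
          exact mul_le_mul (hkT i) (hJnorm x) (norm_nonneg _) (half_pos hδ).le
      _ = 1 / 2 * ‖x‖ := by field_simp
  obtain ⟨u, hu⟩ : IsUnit (R * T * J) := by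
    simpa using isUnit_one_sub_of_norm_lt_one (hclose.trans_lt (by norm_num))
  refine ⟨↑u⁻¹ * R, J, ?_⟩
  rw [mul_assoc, mul_assoc, ← mul_assoc R, ← hu, Units.inv_mul]

theorem exists_mul_mul_eq_one_of_le_norm [CompleteSpace X] (T : X →L[𝕜] X) {f g : ι → ι}
    (hf : Injective f) (hg : Injective g) {δ : ℝ} (hδ : 0 < δ)
    (hT : ∀ i, δ ≤ ‖V.toFun (T (V.single (g i))) (f i)‖) :
    ∃ A B : X →L[𝕜] X, A * T * B = 1 := by
  classical
  obtain ⟨J, hJ, hJ0⟩ := V.exists_relabel hg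
  obtain ⟨R, hR⟩ := V.exists_compRight hf (fun _ ↦ (1 : 𝕜)) zero_le_one (by simp)
  have hJs (i : ι) : J (V.single i) = V.single (g i) := by
    refine V.toFun_injective (funext fun j ↦ ?_)
    by_cases hj : j ∈ range g
    · obtain ⟨l, rfl⟩ := hj
      simp [hJ, Pi.single_apply, hg.eq_iff]
    · rw [hJ0 _ j hj, toFun_single, Pi.single_eq_of_ne]
      rintro rfl
      exact hj (mem_range_self i)
  obtain ⟨A, B, hAB⟩ := V.exists_mul_mul_eq_one_of_le_norm_diag (R * T * J) hδ fun i ↦ by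
    change δ ≤ ‖V.toFun (R (T (J (V.single i)))) i‖
    rw [hJs, hR, one_mul]
    exact hT i
  exact ⟨A * R, J * B, by simpa only [mul_assoc] using hAB⟩

/-- The large coordinates of the vectors `U e_i` can be chosen distinct along a set of full
cardinality, because each coordinate functional of `U` is large at only finitely many `e_i`. -/
theorem exists_mul_mul_eq_one_of_le_norm_apply [CompleteSpace X] (V : SymmetricSupSpace 𝕜 ι X)
    (U : X →L[𝕜] X) {c : ℝ} (hc : 0 < c) (hU : ∀ x, c * ‖x‖ ≤ ‖U x‖) : ∃ A B : X →L[𝕜] X, A * U * B = 1 := by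
  have hex (i : ι) : ∃ j, c / 2 ≤ ‖V.toFun (U (V.single i)) j‖ := by
    by_contra! h
    have h1 := V.norm_le _ _ (half_pos hc).le fun j ↦ (h j).le
    have h2 := hU (V.single i)
    rw [V.norm_single] at h2
    linarith
  choose f hf using hex
  obtain ⟨g, hg, hfg⟩ := exists_injective_comp_of_finite_fibers f fun j ↦
    (V.finite_setOf_le_norm_apply_single ((V.coord j).comp U) (half_pos hc)).subset <| by
      rintro i rfl
      exact hf i
  exact V.exists_mul_mul_eq_one_of_le_norm U hfg hg (half_pos hc) fun i ↦ hf (g i)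

/-- On the diagonal, `P` and `Q` sum to `1`, so at each index one of them is at least `1/2`. -/
theorem exists_mul_mul_eq_one_or_of_add_eq_one [CompleteSpace X] (V : SymmetricSupSpace 𝕜 ι X)
    (P Q : X →L[𝕜] X) (h : P + Q = 1) :
    (∃ A B : X →L[𝕜] X, A * P * B = 1) ∨ ∃ A B : X →L[𝕜] X, A * Q * B = 1 := by
  have hor (i : ι) : 1 / 2 ≤ ‖V.toFun (P (V.single i)) i‖ ∨
      1 / 2 ≤ ‖V.toFun (Q (V.single i)) i‖ := by
    classical
    by_contra! hlt
    have h1 : V.toFun (P (V.single i)) i + V.toFun (Q (V.single i)) i = 1 := by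
      rw [← Pi.add_apply, ← map_add, ← add_apply, h]
      simp
    have h2 := norm_add_le (V.toFun (P (V.single i)) i) (V.toFun (Q (V.single i)) i)
    rw [h1, norm_one] at h2
    linarith [hlt.1, hlt.2]
  refine (exists_injective_forall_or_forall hor).imp ?_ ?_ <;> rintro ⟨g, hg, hgT⟩
  · exact V.exists_mul_mul_eq_one_of_le_norm P hg hg one_half_pos hgT
  · exact V.exists_mul_mul_eq_one_of_le_norm Q hg hg one_half_pos hgT

/-- Boundedness below on a copy is the same as a factorisation of the identity: one direction is
`exists_mul_mul_eq_one_of_le_norm_apply`; in the other the copy is the range of the right factor. -/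
theorem boundedBelowOnCopy_iff [CompleteSpace X] (V : SymmetricSupSpace 𝕜 ι X) (T : X →L[𝕜] X) :
    BoundedBelowOnCopy X T ↔ ∃ A B : X →L[𝕜] X, A * T * B = 1 := by
  constructor
  · rintro ⟨E₀, ⟨φ⟩, c, hc, hT⟩
    let S : X →L[𝕜] X := E₀.subtypeL.comp (φ.symm : X →L[𝕜] E₀)
    have hφ (x : X) : ‖x‖ ≤ (‖(φ : E₀ →L[𝕜] X)‖ + 1) * ‖S x‖ := by
      have h1 := (φ : E₀ →L[𝕜] X).le_opNorm (φ.symm x)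
      have h2 : ‖S x‖ = ‖φ.symm x‖ := rfl
      rw [ContinuousLinearEquiv.coe_coe, φ.apply_symm_apply] at h1
      rw [h2]
      nlinarith [norm_nonneg (φ.symm x)]
    have hpos : 0 < ‖(φ : E₀ →L[𝕜] X)‖ + 1 := by positivity
    obtain ⟨A, B, hAB⟩ := V.exists_mul_mul_eq_one_of_le_norm_apply (T * S)
      (div_pos hc hpos) fun x ↦ by
        refine le_trans ?_ (hT (S x) (φ.symm x).2)
        rw [div_mul_eq_mul_div, div_le_iff₀ hpos, mul_assoc, mul_comm ‖S x‖]
        exact mul_le_mul_of_nonneg_left (hφ x) hc.le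
    exact ⟨A, S * B, by simpa only [mul_assoc] using hAB⟩
  · rintro ⟨A, B, hAB⟩
    have hinv (x : X) : A (T (B x)) = x := DFunLike.congr_fun hAB x
    refine ⟨LinearMap.range (B : X →ₗ[𝕜] X), ⟨ContinuousLinearEquiv.equivOfInverse
      ((A.comp T).comp (Submodule.subtypeL _)) (B.codRestrict _ fun x ↦ ⟨x, rfl⟩) ?_ ?_⟩,
      ((‖A‖ + 1) * (‖B‖ + 1))⁻¹, by positivity, ?_⟩
    · rintro ⟨_, x, rfl⟩
      exact Subtype.ext (congrArg B (hinv x))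
    · exact hinv
    · rintro _ ⟨x, rfl⟩
      change _ * ‖B x‖ ≤ ‖T (B x)‖
      have h1 := B.le_opNorm x
      have h2 := A.le_opNorm (T (B x))
      rw [hinv] at h2
      rw [inv_mul_le_iff₀ (by positivity)]
      have hT0 := norm_nonneg (T (B x))
      calc ‖B x‖ ≤ ‖B‖ * (‖A‖ * ‖T (B x)‖) := h1.trans (by gcongr)
        _ ≤ (‖B‖ + 1) * ((‖A‖ + 1) * ‖T (B x)‖) := by gcongr <;> linarith
        _ = _ := by ring

theorem singularOperators_eq_and_isUniqueMaximalIdeal [CompleteSpace X]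
    (V : SymmetricSupSpace 𝕜 ι X) :
    singularOperators 𝕜 X X X =
        {T : X →L[𝕜] X | ∀ A B : X →L[𝕜] X, ContinuousLinearMap.id 𝕜 X ≠ A.comp (T.comp B)} ∧
      IsUniqueMaximalIdeal (singularOperators 𝕜 X X X) := by
  have h1 : singularOperators 𝕜 X X X = {T : X →L[𝕜] X | ∀ A B, A * T * B ≠ 1} := by
    ext T
    simp [singularOperators, V.boundedBelowOnCopy_iff]
  have hnt : Nontrivial X := by
    obtain ⟨i⟩ := (inferInstance : Nonempty ι)
    refine ⟨V.single i, 0, fun h ↦ ?_⟩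
    simpa [h] using V.norm_single i
  refine ⟨?_, ?_⟩
  · rw [h1]
    ext T
    exact forall₂_congr fun A B ↦ ne_comm
  · rw [h1]
    exact isUniqueMaximalIdeal_of_add_mem V.exists_mul_mul_eq_one_or_of_add_eq_one

end SymmetricSupSpace

/-! ### The two spaces of the theorem -/

section

variable (𝕜 ι : Type*) [RCLike 𝕜]

/-- `ℓ_∞(ι)` contains every bounded function. -/
noncomputable def lInftySymmetricSupSpace : SymmetricSupSpace 𝕜 ι (LInfty 𝕜 ι) where
  toFun :=
    { toFun := fun x ↦ x
      map_add' := fun _ _ ↦ rfl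
      map_smul' := fun _ _ ↦ rfl }
  norm_toFun_le x i := lp.norm_apply_le_norm ENNReal.top_ne_zero x i
  norm_le _ _ hC h := lp.norm_le_of_forall_le hC h
  exists_single i := by
    classical
    exact ⟨lp.single ⊤ i 1, lp.coeFn_single (E := fun _ : ι ↦ 𝕜) ⊤ i 1⟩
  exists_of_support_subset x u C σ hu _ :=
    ⟨⟨u, memℓp_infty ⟨C, by rintro _ ⟨i, rfl⟩; exact hu i⟩⟩, rfl⟩

/-- `ℓ_∞^c(ι)` is closed under moving supports because images of countable sets are countable. -/
noncomputable def lInftyCountableSymmetricSupSpace : SymmetricSupSpace 𝕜 ι (LInftyCountable 𝕜 ι) where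
  toFun := (lInftySymmetricSupSpace 𝕜 ι).toFun.comp (LInftyCountable 𝕜 ι).subtype
  norm_toFun_le x i := (lInftySymmetricSupSpace 𝕜 ι).norm_toFun_le x i
  norm_le x C hC h := (lInftySymmetricSupSpace 𝕜 ι).norm_le x C hC h
  exists_single i := by
    classical
    obtain ⟨x, hx⟩ := (lInftySymmetricSupSpace 𝕜 ι).exists_single i
    refine ⟨⟨x, (Set.countable_singleton i).mono fun j hj ↦ ?_⟩, hx⟩
    by_contra hne
    exact hj ((congrFun hx j).trans (Pi.single_eq_of_ne hne 1))
  exists_of_support_subset x u C σ hu hs := by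
    obtain ⟨y, hy⟩ := (lInftySymmetricSupSpace 𝕜 ι).exists_of_support_subset x.1 u C σ hu hs
    refine ⟨⟨y, (Set.Countable.image x.2 σ).mono fun j hj ↦ hs ?_⟩, hy⟩
    exact fun h ↦ hj ((congrFun hy j).trans h)

/-- The support of a limit of a sequence lies in the union of the supports of its terms. -/
theorem isClosed_lInftyCountable : IsClosed (LInftyCountable 𝕜 ι : Set (LInfty 𝕜 ι)) := by
  refine IsSeqClosed.isClosed fun z w hz hw ↦ ?_
  refine (Set.countable_iUnion hz).mono fun i hi ↦ ?_
  by_contra hcon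
  have h0 (n : ℕ) : z n i = 0 := by
    by_contra h
    exact hcon (Set.mem_iUnion.2 ⟨n, h⟩)
  have h1 : Filter.Tendsto (fun n ↦ z n i) Filter.atTop (nhds (w i)) :=
    ((lInftySymmetricSupSpace 𝕜 ι).coord i).continuous.continuousAt.tendsto.comp hw
  simp only [h0] at h1
  exact hi (tendsto_nhds_unique h1 tendsto_const_nhds)

instance : CompleteSpace (LInftyCountable 𝕜 ι) :=
  (isClosed_lInftyCountable 𝕜 ι).completeSpace_coe

end

end OperatorIdeals

theorem theorem1p1 {𝕜 : Type*} [RCLike 𝕜] {ι : Type*} [Infinite ι] :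
    (OperatorIdeals.singularOperators 𝕜 (OperatorIdeals.LInfty 𝕜 ι)
          (OperatorIdeals.LInfty 𝕜 ι) (OperatorIdeals.LInfty 𝕜 ι)
        = {T : OperatorIdeals.LInfty 𝕜 ι →L[𝕜] OperatorIdeals.LInfty 𝕜 ι |
            ∀ A B : OperatorIdeals.LInfty 𝕜 ι →L[𝕜] OperatorIdeals.LInfty 𝕜 ι,
              ContinuousLinearMap.id 𝕜 (OperatorIdeals.LInfty 𝕜 ι) ≠ A.comp (T.comp B)} ∧
      OperatorIdeals.IsUniqueMaximalIdeal
        (OperatorIdeals.singularOperators 𝕜 (OperatorIdeals.LInfty 𝕜 ι)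
          (OperatorIdeals.LInfty 𝕜 ι) (OperatorIdeals.LInfty 𝕜 ι))) ∧
    (OperatorIdeals.singularOperators 𝕜 (OperatorIdeals.LInftyCountable 𝕜 ι)
          (OperatorIdeals.LInftyCountable 𝕜 ι) (OperatorIdeals.LInftyCountable 𝕜 ι)
        = {T : OperatorIdeals.LInftyCountable 𝕜 ι →L[𝕜] OperatorIdeals.LInftyCountable 𝕜 ι |
            ∀ A B : OperatorIdeals.LInftyCountable 𝕜 ι →L[𝕜] OperatorIdeals.LInftyCountable 𝕜 ι,
              ContinuousLinearMap.id 𝕜 (OperatorIdeals.LInftyCountable 𝕜 ι)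
                ≠ A.comp (T.comp B)} ∧
      OperatorIdeals.IsUniqueMaximalIdeal
        (OperatorIdeals.singularOperators 𝕜 (OperatorIdeals.LInftyCountable 𝕜 ι)
          (OperatorIdeals.LInftyCountable 𝕜 ι) (OperatorIdeals.LInftyCountable 𝕜 ι))) :=
  ⟨(OperatorIdeals.lInftySymmetricSupSpace 𝕜 ι).singularOperators_eq_and_isUniqueMaximalIdeal,
    (OperatorIdeals.lInftyCountableSymmetricSupSpace 𝕜
      ι).singularOperators_eq_and_isUniqueMaximalIdeal⟩
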